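/- Define the morphism $g$ on $\{0,1,2,3\}^*$ by $g(0)=01$, $g(1)=20$, $g(2)=23$, $g(3)=02$ and the coding $\tau$ by $\tau(0)=2$, $\tau(1)=1$, $\tau(2)=0$, $\tau(3)=1$, and let $\mathbf{vtm}=\tau(g^\omega(0))=2102012101202102012\cdots$. Let $\sigma:\{0,1,2\}^*\to\{0,1\}^*$ be Ochem's morphism $$\begin{aligned}\sigma(0)&=00011001011000111001011001110001011100101100010111,\\ \sigma(1)&=00011001011000101110010110011100010110001110010111,\\ \sigma(2)&=00011001011000101110010110001110010111000101100111.\end{aligned}$$ Then $\sigma$ is $50$-uniform (all three images have length $50$), and $\mathbf{vtm}$ is not $(7/4+\epsilon)$-free, that is, it has a factor of some length $n$ with a period $p$, $1\le p\le n$, such that $n/p>7/4$. Nevertheless, the infinite binary word $\sigma(\mathbf{vtm})$ has the following properties. (i) It is $2$-automatic: it is the image, under a coding (a letter-to-letter map), of a fixed point $h^\omega(a)$ of a $2$-uniform morphism $h$ over a finite alphabet. (ii) It contains exactly three distinct squares, i.e. exactly three distinct finite words of the form $uu$ with $u$ nonempty occur in it as blocks of consecutive letters. (iii) It is generated by a deterministic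 finite automaton with output that has $109$ states and reads the base-$2$ representation of $n$, most significant digit first, in order to output the letter at position $n$ (counting from $0$); no such automaton with fewer states generates it. (iv) Its weight as a $2$-automatic word is $2\cdot 109=218$: this is the least value of $\sum_{b\in\Sigma}|h(b)|$ over all $2$-uniform morphisms $h:\Sigma^*\to\Sigma^*$, $\Sigma$ a finite alphabet, such that $\sigma(\mathbf{vtm})$ is the image, under a coding, of a fixed point of $h$ obtained by iterating $h$ on a letter. -/

import Mathlib

namespace SquareWords

/-! Infinite words over an alphabet `A` are functions `ℕ → A`, indexed from `0`. -/

/-- A morphism of free monoids from `A*` to `B*`, given by its images of letters. -/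
abbrev Morphism (A B : Type) := A → List B

/-- The action of a morphism on finite words. -/
def Morphism.onList {A B : Type} (h : Morphism A B) (w : List A) : List B :=
  w.flatMap h

/-- The image of an infinite word: the letter at position `n` of `h(x 0) h(x 1) h(x 2) ⋯`.
For a nonerasing `h` the first `n + 1` blocks already have total length at least `n + 1`,
so that the default value is not used. -/
def Morphism.onWord {A B : Type} [Inhabited B] (h : Morphism A B) (x : ℕ → A) : ℕ → B :=
  fun n => (h.onList ((List.range (n + 1)).map x)).getD n default

/-- `h` is `k`-uniform. -/
def Morphism.IsUniform {A B : Type} (k : ℕ) (h : Morphism A B) : Prop :=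
  ∀ a, (h a).length = k

/-- The weight of a morphism `h : A* → A*`: the sum of the lengths of the images of letters. -/
def Morphism.weight {A : Type} [Fintype A] (h : Morphism A A) : ℕ :=
  ∑ a, (h a).length

/-- `h` can be iterated on `a` to give an infinite word: `h(a) = a t` and no iterate
`h^i(t)` is empty. -/
def Morphism.IsProlongable {A : Type} (h : Morphism A A) (a : A) : Prop :=
  ∃ t : List A, h a = a :: t ∧ ∀ i : ℕ, h.onList^[i] t ≠ []

/-- The fixed point `h^ω(a)`. When `h` is prolongable on `a`, each `h^n(a)` is a prefix of
`h^(n+1)(a)` and has length at least `n + 1`, so that the default value is not used. -/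
def Morphism.omega {A : Type} (h : Morphism A A) (a : A) : ℕ → A :=
  fun n => (h.onList^[n] [a]).getD n a

/-- The infinite word `x` is the image, under the coding `c`, of the fixed point `h^ω(a)` of
the `k`-uniform morphism `h`. -/
def IsDefinedBy {A B : Type} (k : ℕ) (h : Morphism A A) (a : A) (c : A → B) (x : ℕ → B) :
    Prop :=
  h.IsUniform k ∧ h.IsProlongable a ∧ ∀ n, x n = c (h.omega a n)

/-- The infinite word `x` is `k`-automatic: it is the image, under a coding, of a fixed point of
a `k`-uniform morphism over a finite alphabet. -/
def IsAutomatic {B : Type} (k : ℕ) (x : ℕ → B) : Prop :=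
  ∃ (s : ℕ) (h : Morphism (Fin s) (Fin s)) (a : Fin s) (c : Fin s → B), IsDefinedBy k h a c x

/-- The weights of all `k`-uniform morphisms that define `x` as a `k`-automatic word. -/
def definingWeights {B : Type} (k : ℕ) (x : ℕ → B) : Set ℕ :=
  {w | ∃ (s : ℕ) (h : Morphism (Fin s) (Fin s)) (a : Fin s) (c : Fin s → B),
    IsDefinedBy k h a c x ∧ h.weight = w}

/-- A deterministic finite automaton with output, with state set `Q`, reading base-`k` digits. -/
structure DFAO (k : ℕ) (Q B : Type) where
  /-- the initial state -/
  start : Q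
  /-- the transition function -/
  step : Q → Fin k → Q
  /-- the output of a state -/
  out : Q → B

/-- The state reached after reading a word of digits from left to right. -/
def DFAO.run {k : ℕ} {Q B : Type} (M : DFAO k Q B) (w : List (Fin k)) : Q :=
  w.foldl M.step M.start

/-- The base-`k` representation of `n`, most significant digit first, without leading zeros
(the representation of `0` is the empty word). -/
def baseRep (k : ℕ) [NeZero k] (n : ℕ) : List (Fin k) :=
  ((Nat.digits k n).map (Fin.ofNat k)).reverse

/-- `M` generates `x`: on the base-`k` representation of `n` its output is `x n`. -/
def DFAO.Generates {k : ℕ} [NeZero k] {Q B : Type} (M : DFAO k Q B) (x : ℕ → B) : Prop :=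
  ∀ n, M.out (M.run (baseRep k n)) = x n

/-- The numbers of states of all base-`k` automata that generate `x`. -/
def automatonSizes {B : Type} (k : ℕ) [NeZero k] (x : ℕ → B) : Set ℕ :=
  {s | ∃ M : DFAO k (Fin s) B, M.Generates x}

/-- The finite word `w` occurs in `x` (as a block of consecutive letters). -/
def IsFactor {B : Type} (w : List B) (x : ℕ → B) : Prop :=
  ∃ i : ℕ, w = (List.range w.length).map (fun t => x (i + t))

/-- The set of squares `uu`, with `u` nonempty, that occur in `x`. -/
def squaresIn {B : Type} (x : ℕ → B) : Set (List B) :=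
  {w | IsFactor w x ∧ ∃ u : List B, u ≠ [] ∧ w = u ++ u}

/-- No factor of `x` has exponent greater than `α`: if a factor of length `n` has a period
`p` with `1 ≤ p ≤ n`, then `n / p ≤ α`. -/
def IsPlusFree {B : Type} (α : ℚ) (x : ℕ → B) : Prop :=
  ∀ i n p : ℕ, 1 ≤ p → p ≤ n → (∀ t, t + p < n → x (i + t) = x (i + t + p)) →
    (n : ℚ) / (p : ℚ) ≤ α

/-- The morphism `0 ↦ 01, 1 ↦ 20, 2 ↦ 23, 3 ↦ 02`. -/
def g : Morphism (Fin 4) (Fin 4) := ![[0, 1], [2, 0], [2, 3], [0, 2]]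

/-- The coding `0 ↦ 2, 1 ↦ 1, 2 ↦ 0, 3 ↦ 1`. -/
def tau : Fin 4 → Fin 3 := ![2, 1, 0, 1]

/-- The word `vtm = τ(g^ω(0)) = 2102012101202102012021012102012⋯`. -/
def vtm : ℕ → Fin 3 := fun n => tau (g.omega 0 n)

/-- Ochem's morphism `σ`. -/
def sigma : Morphism (Fin 3) (Fin 2) :=
  ![[0, 0, 0, 1, 1, 0, 0, 1, 0, 1, 1, 0, 0, 0, 1, 1, 1, 0, 0, 1, 0, 1, 1, 0, 0,
      1, 1, 1, 0, 0, 0, 1, 0, 1, 1, 1, 0, 0, 1, 0, 1, 1, 0, 0, 0, 1, 0, 1, 1, 1],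
    [0, 0, 0, 1, 1, 0, 0, 1, 0, 1, 1, 0, 0, 0, 1, 0, 1, 1, 1, 0, 0, 1, 0, 1, 1,
      0, 0, 1, 1, 1, 0, 0, 0, 1, 0, 1, 1, 0, 0, 0, 1, 1, 1, 0, 0, 1, 0, 1, 1, 1],
    [0, 0, 0, 1, 1, 0, 0, 1, 0, 1, 1, 0, 0, 0, 1, 0, 1, 1, 1, 0, 0, 1, 0, 1, 1,
      0, 0, 0, 1, 1, 1, 0, 0, 1, 0, 1, 1, 1, 0, 0, 0, 1, 0, 1, 1, 0, 0, 1, 1, 1]]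

end SquareWords

/-! Squares. Coding adjacent pairs of Thue–Morse letters turns `g.omega 0` into Thue–Morse and `vtm`
into its shifted difference word, so overlap-freeness of Thue–Morse gives `vtm_squareFree`. A square
of period below 55 in the image lies in the image of four consecutive letters, and only twelve such
blocks exist: a finite check (`short_squares`). A longer period must be a multiple of 50, because
the first half contains the synchronizing prefix `000110`; the square then pulls back to one in
`vtm` (`ochemWord_no_long_square`).

Automata. Position `n` is tracked by the letter of `g.omega 0` at `n / 50` and by `n % 50`, which
gives 200 states, all reachable. As in Myhill–Nerode, their outputs on continuations of length at
most 4 take 109 values, a lower bound for every automaton (`card_behaviour_blockDFAO`). An explicit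
congruence with 109 classes attains it (`stateClass_step`). A 2-uniform morphism on `s` letters has
weight `2 * s` and yields an automaton with `s` states, so the weight bound follows. -/

namespace SquareWords

/-! ### Fixed points of uniform morphisms -/

section Uniform

variable {A B : Type} {k : ℕ}

lemma Morphism.IsUniform.length_onList {h : Morphism A B} (hu : h.IsUniform k) (w : List A) :
    (h.onList w).length = k * w.length := by
  induction w with
  | nil => simp [Morphism.onList]
  | cons a w ih =>
    simp only [Morphism.onList, List.flatMap_cons, List.length_append, List.length_cons] at ih ⊢
    rw [ih, hu a]; ring

lemma Morphism.IsUniform.getElem?_onList {h : Morphism A B} (hu : h.IsUniform k) (w : List A)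
    {m d : ℕ} (hd : d < k) : (h.onList w)[k * m + d]? = w[m]? >>= fun a => (h a)[d]? := by
  induction w generalizing m with
  | nil => simp [Morphism.onList]
  | cons a w ih =>
    have ha := hu a
    simp only [Morphism.onList, List.flatMap_cons] at ih ⊢
    cases m with
    | zero => rw [List.getElem?_append_left (by simpa [ha] using hd)]; simp
    | succ m =>
      have e : k * (m + 1) + d - k = k * m + d := by
        rw [Nat.mul_succ]; omega
      rw [List.getElem?_append_right (by rw [ha, Nat.mul_succ]; omega), ha, e, ih]
      simp

lemma Morphism.IsUniform.onWord_apply [Inhabited B] {h : Morphism A B} (hu : h.IsUniform k)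
    (x : ℕ → A) (m : ℕ) {d : ℕ} (hd : d < k) :
    h.onWord x (k * m + d) = (h (x m)).getD d default := by
  have hm : m < k * m + d + 1 := by nlinarith
  simp only [Morphism.onWord, List.getD_eq_getElem?_getD, hu.getElem?_onList _ hd]
  simp [hm]

lemma Morphism.IsUniform.length_iterate {h : Morphism A A} (hu : h.IsUniform k) (n : ℕ)
    (w : List A) : (h.onList^[n] w).length = k ^ n * w.length := by
  induction n with
  | zero => simp
  | succ n ih => rw [Function.iterate_succ_apply', hu.length_onList, ih]; ring

lemma Morphism.onList_append (h : Morphism A B) (v w : List A) :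
    h.onList (v ++ w) = h.onList v ++ h.onList w := by
  simp [Morphism.onList]

lemma Morphism.iterate_prefix_succ {h : Morphism A A} {a : A} {t : List A} (ha : h a = a :: t)
    (n : ℕ) : h.onList^[n] [a] <+: h.onList^[n + 1] [a] := by
  induction n with
  | zero => simp [Morphism.onList, ha]
  | succ n ih =>
    rw [Function.iterate_succ_apply', Function.iterate_succ_apply' _ (n + 1)]
    obtain ⟨s, hs⟩ := ih
    rw [← hs, Morphism.onList_append]
    exact List.prefix_append _ _

lemma Morphism.iterate_prefix {h : Morphism A A} {a : A} {t : List A} (ha : h a = a :: t)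
    {m n : ℕ} (hmn : m ≤ n) : h.onList^[m] [a] <+: h.onList^[n] [a] := by
  induction n, hmn using Nat.le_induction with
  | base => exact List.prefix_rfl
  | succ n _ ih => exact ih.trans (Morphism.iterate_prefix_succ ha n)

lemma Morphism.IsUniform.getElem?_iterate {h : Morphism A A} (hu : h.IsUniform k) (hk : 1 < k)
    {a : A} {t : List A} (ha : h a = a :: t) {m N : ℕ} (hm : m < k ^ N) :
    (h.onList^[N] [a])[m]? = some (h.omega a m) := by
  have l1 : m < (h.onList^[N] [a]).length := by simpa [hu.length_iterate] using hm
  have l2 : m < (h.onList^[m] [a]).length := by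
    simpa [hu.length_iterate] using Nat.lt_pow_self hk
  have key : (h.onList^[N] [a])[m]? = (h.onList^[m] [a])[m]? := by
    rcases le_total m N with hle | hle
    · obtain ⟨s, hs⟩ := Morphism.iterate_prefix ha hle
      rw [← hs, List.getElem?_append_left l2]
    · obtain ⟨s, hs⟩ := Morphism.iterate_prefix ha hle
      rw [← hs, List.getElem?_append_left l1]
  rw [key, Morphism.omega, List.getD_eq_getElem?_getD, List.getElem?_eq_getElem l2]
  rfl

/-- The fixed point of a uniform morphism reproduces itself under the morphism. -/
lemma Morphism.IsUniform.omega_mul_add {h : Morphism A A} (hu : h.IsUniform k) (hk : 1 < k)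
    {a : A} {t : List A} (ha : h a = a :: t) (m : ℕ) {d : ℕ} (hd : d < k) (e : A) :
    h.omega a (k * m + d) = (h (h.omega a m)).getD d e := by
  have hm : m < k ^ m := Nat.lt_pow_self hk
  have h1 : k * m + d < k ^ (m + 1) := by
    have : k * (m + 1) ≤ k * k ^ m := Nat.mul_le_mul_left _ hm
    rw [pow_succ']; rw [Nat.mul_succ] at this; omega
  have h2 := hu.getElem?_iterate hk ha h1
  rw [Function.iterate_succ_apply', hu.getElem?_onList _ hd, hu.getElem?_iterate hk ha hm] at h2
  rw [List.getD_eq_getElem?_getD, show (h (h.omega a m))[d]? = some (h.omega a (k * m + d)) from h2]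
  rfl

lemma Morphism.omega_zero (h : Morphism A A) (a : A) : h.omega a 0 = a := rfl

/-- A word that starts with `a` and reproduces itself under `h` is `h^ω(a)`. -/
lemma Morphism.IsUniform.omega_eq {h : Morphism A A} (hu : h.IsUniform k) (hk : 1 < k)
    {a : A} {t : List A} (ha : h a = a :: t) {y : ℕ → A} (y0 : y 0 = a)
    (hy : ∀ m d, d < k → y (k * m + d) = (h (y m)).getD d a) (n : ℕ) : h.omega a n = y n := by
  induction n using Nat.strong_induction_on with
  | _ n ih =>
    rcases Nat.eq_zero_or_pos n with rfl | hn
    · rw [y0, Morphism.omega_zero]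
    · have hlt : n / k < n := Nat.div_lt_self hn hk
      have hd : n % k < k := Nat.mod_lt _ (by omega)
      rw [← Nat.div_add_mod n k, hu.omega_mul_add hk ha _ hd a, ih _ hlt, hy _ _ hd]

lemma Morphism.IsUniform.isProlongable {h : Morphism A A} (hu : h.IsUniform k) (hk : 1 < k)
    {a : A} {t : List A} (ha : h a = a :: t) : h.IsProlongable a := by
  refine ⟨t, ha, fun i hi => ?_⟩
  have hl := hu.length_iterate i t
  have := hu a
  rw [ha, List.length_cons] at this
  rw [hi, List.length_nil] at hl
  have : 0 < k ^ i * t.length := Nat.mul_pos (by positivity) (by omega)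
  omega

lemma Morphism.IsUniform.weight_eq {s : ℕ} {h : Morphism (Fin s) (Fin s)} (hu : h.IsUniform k) :
    h.weight = k * s := by
  simp only [Morphism.weight, hu _]
  simp [mul_comm]

end Uniform

/-! ### Automata, and a lower bound on the number of states -/

section Automata

variable {B Q : Type} {k : ℕ}

lemma baseRep_zero [NeZero k] : baseRep k 0 = [] := by simp [baseRep]

lemma baseRep_mul_add [NeZero k] (hk : 1 < k) (m : ℕ) (d : Fin k) (h : 0 < k * m + d) :
    baseRep k (k * m + d) = baseRep k m ++ [d] := by
  have : Nat.digits k (k * m + d) = (d : ℕ) :: Nat.digits k m := by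
    rw [Nat.digits_def' hk h, Nat.mul_add_mod, Nat.mod_eq_of_lt d.2,
      Nat.mul_add_div (by omega), Nat.div_eq_of_lt d.2, add_zero]
  simp [baseRep, this]

lemma DFAO.run_baseRep_mul_add [NeZero k] (hk : 1 < k) (M : DFAO k Q B) (m : ℕ) (d : Fin k)
    (h : 0 < k * m + d) :
    M.run (baseRep k (k * m + d)) = M.step (M.run (baseRep k m)) d := by
  rw [baseRep_mul_add hk m d h]; simp [DFAO.run]

/-- The automaton that reads off the fixed point of a uniform morphism and applies a coding. -/
def Morphism.toDFAO (h : Morphism Q Q) (a : Q) (c : Q → B) : DFAO k Q B where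
  start := a
  step q d := (h q).getD d a
  out := c

lemma IsDefinedBy.generates [NeZero k] (hk : 1 < k) {h : Morphism Q Q} {a : Q} {c : Q → B}
    {x : ℕ → B} (hx : IsDefinedBy k h a c x) :
    (h.toDFAO a c : DFAO k Q B).Generates x := by
  obtain ⟨hu, ⟨t, ha, -⟩, hc⟩ := hx
  intro n
  rw [hc n]
  suffices (h.toDFAO a c : DFAO k Q B).run (baseRep k n) = h.omega a n by rw [this]; rfl
  induction n using Nat.strong_induction_on with
  | _ n ih =>
    rcases Nat.eq_zero_or_pos n with rfl | hn
    · rw [baseRep_zero, Morphism.omega_zero]; rfl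
    · have hlt : n / k < n := Nat.div_lt_self hn hk
      have hd : n % k < k := Nat.mod_lt _ (by omega)
      have e := Nat.div_add_mod n k
      have := DFAO.run_baseRep_mul_add hk (h.toDFAO a c : DFAO k Q B) (n / k) ⟨n % k, hd⟩
        (by simpa [e] using hn)
      simp only [e] at this
      rw [this, ih _ hlt]
      conv_rhs => rw [← e, hu.omega_mul_add hk ha _ hd a]
      rfl

/-- The outputs of an automaton on all continuations by at most `j` digits, from the state `q`. -/
def DFAO.behaviour (M : DFAO k Q B) : ℕ → Q → List B
  | 0, q => [M.out q]
  | j + 1, q => M.out q :: (List.finRange k).flatMap fun d => M.behaviour j (M.step q d)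

/-- The values of `x` at the numbers obtained from `n` by appending at most `j` digits. -/
def continuations (k : ℕ) (x : ℕ → B) : ℕ → ℕ → List B
  | 0, n => [x n]
  | j + 1, n => x n :: (List.finRange k).flatMap fun d : Fin k => continuations k x j (k * n + d)

/-- The right side does not mention `M`, so any two automata generating `x` can be compared.
Positivity matters: appending the digit 0 to the empty representation of 0 does not give a
representation. -/
lemma DFAO.Generates.behaviour_eq [NeZero k] (hk : 1 < k) {M : DFAO k Q B} {x : ℕ → B}
    (hM : M.Generates x) (j : ℕ) {n : ℕ} (hn : 0 < n) :
    M.behaviour j (M.run (baseRep k n)) = continuations k x j n := by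
  induction j generalizing n with
  | zero => simp [DFAO.behaviour, continuations, hM n]
  | succ j ih =>
    simp only [DFAO.behaviour, continuations, hM n]
    congr 2
    funext d
    have hpos : 0 < k * n + d := by positivity
    rw [← ih hpos, M.run_baseRep_mul_add hk n d hpos]

/-- An automaton that generates the same word as `N` has at least as many states as `N` has
behaviours, provided that all states of `N` are reached by positive numbers. -/
lemma DFAO.Generates.card_behaviour_le [NeZero k] (hk : 1 < k) [Fintype Q] [DecidableEq B] {s : ℕ}
    {M : DFAO k (Fin s) B} {N : DFAO k Q B} {x : ℕ → B} (hM : M.Generates x)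
    (hN : N.Generates x) (hreach : ∀ q, ∃ n > 0, N.run (baseRep k n) = q) (j : ℕ) :
    (Finset.univ.image (N.behaviour j)).card ≤ s := by
  calc (Finset.univ.image (N.behaviour j)).card
      ≤ (Finset.univ.image (M.behaviour j)).card := by
        apply Finset.card_le_card
        intro y hy
        obtain ⟨q, -, rfl⟩ := Finset.mem_image.1 hy
        obtain ⟨n, hn, rfl⟩ := hreach q
        rw [hN.behaviour_eq hk j hn, ← hM.behaviour_eq hk j hn]
        exact Finset.mem_image_of_mem _ (Finset.mem_univ _)
    _ ≤ (Finset.univ : Finset (Fin s)).card := Finset.card_image_le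
    _ = s := by simp

end Automata


/-! ### Overlap-freeness of the Thue–Morse word -/

section ThueMorse

/-- The Thue–Morse word. -/
def thueMorse : ℕ → Bool
  | 0 => false
  | n + 1 => xor ((n + 1) % 2 == 1) (thueMorse ((n + 1) / 2))

lemma thueMorse_two_mul (n : ℕ) : thueMorse (2 * n) = thueMorse n := by
  rcases n with _ | n
  · rfl
  · rw [show 2 * (n + 1) = (2 * n + 1) + 1 by ring, thueMorse,
      show (2 * n + 1 + 1) % 2 = 0 by omega, show (2 * n + 1 + 1) / 2 = n + 1 by omega]
    simp

lemma thueMorse_two_mul_add_one (n : ℕ) : thueMorse (2 * n + 1) = !thueMorse n := by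
  rw [thueMorse, show (2 * n + 1) % 2 = 1 by omega, show (2 * n + 1) / 2 = n by omega]
  simp

lemma thueMorse_succ_of_even {n : ℕ} (hn : n % 2 = 0) : thueMorse (n + 1) = !thueMorse n := by
  obtain ⟨m, rfl⟩ : ∃ m, n = 2 * m := ⟨n / 2, by omega⟩
  rw [thueMorse_two_mul_add_one, thueMorse_two_mul]

lemma thueMorse_no_cube (i : ℕ) (h1 : thueMorse i = thueMorse (i + 1))
    (h2 : thueMorse (i + 1) = thueMorse (i + 2)) : False := by
  rcases Nat.mod_two_eq_zero_or_one i with h | h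
  · rw [thueMorse_succ_of_even h] at h1; simp at h1
  · rw [show i + 2 = i + 1 + 1 by rfl, thueMorse_succ_of_even (n := i + 1) (by omega)] at h2
    simp at h2

/-- The Thue–Morse word contains no overlap. -/
lemma thueMorse_overlapFree {p : ℕ} (hp : 1 ≤ p) (i : ℕ)
    (h : ∀ k ≤ p, thueMorse (i + k) = thueMorse (i + k + p)) : False := by
  induction p using Nat.strong_induction_on generalizing i with
  | _ p ih =>
  rcases Nat.mod_two_eq_zero_or_one p with hpar | hpar
  · obtain ⟨q, rfl⟩ : ∃ q, p = 2 * q := ⟨p / 2, by omega⟩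
    -- Even period: every second letter of the overlap forms an overlap of half the period.
    refine ih q (by omega) (by omega) (i / 2) fun k hk => ?_
    have hk' := h (2 * k) (by omega)
    rcases Nat.mod_two_eq_zero_or_one i with hi | hi
    · rw [show i + 2 * k = 2 * (i / 2 + k) by omega, ← Nat.mul_add, thueMorse_two_mul,
        thueMorse_two_mul] at hk'
      exact hk'
    · rw [show i + 2 * k + 2 * q = 2 * (i / 2 + k + q) + 1 by omega,
        show i + 2 * k = 2 * (i / 2 + k) + 1 by omega, thueMorse_two_mul_add_one,
        thueMorse_two_mul_add_one] at hk'
      simpa using hk'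
  · rcases Nat.lt_or_ge p 2 with h1 | h2
    · obtain rfl : p = 1 := by omega
      exact thueMorse_no_cube i (h 0 (by omega)) (h 1 (by omega))
    · have alt : ∀ k < p, thueMorse (i + k + 1) = !thueMorse (i + k) ∧
          thueMorse (i + k + p + 1) = !thueMorse (i + k + p) := by
        intro k hk
        have e1 := h k (by omega)
        have e2 := h (k + 1) (by omega)
        rw [show i + (k + 1) + p = i + k + p + 1 by omega, ← add_assoc] at e2
        rcases Nat.mod_two_eq_zero_or_one (i + k) with hi | hi
        · have := thueMorse_succ_of_even hi
          exact ⟨this, by rw [← e2, ← e1, this]⟩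
        · have := thueMorse_succ_of_even (n := i + k + p) (by omega)
          exact ⟨by rw [e2, e1, this], this⟩
      have alt' : ∀ k < 2 * p, thueMorse (i + k + 1) = !thueMorse (i + k) := by
        intro k hk
        rcases Nat.lt_or_ge k p with hkp | hkp
        · exact (alt k hkp).1
        · have := (alt (k - p) (by omega)).2
          rwa [show i + (k - p) + p = i + k by omega] at this
      obtain ⟨m, k, hk, hm⟩ : ∃ m k, k ≤ 1 ∧ i + k = 2 * m := by
        rcases Nat.mod_two_eq_zero_or_one i with hi | hi
        · exact ⟨i / 2, 0, by omega, by omega⟩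
        · exact ⟨i / 2 + 1, 1, by omega, by omega⟩
      have step : ∀ j < 4, thueMorse (2 * m + j + 1) = !thueMorse (2 * m + j) := by
        intro j hj
        have := alt' (k + j) (by omega)
        rwa [show i + (k + j) = 2 * m + j by omega] at this
      have s0 := step 0 (by omega)
      have s1 := step 1 (by omega)
      have s2 := step 2 (by omega)
      have s3 := step 3 (by omega)
      simp only [Nat.reduceAdd, add_assoc, add_zero] at s0 s1 s2 s3
      -- Alternation makes the letters at `2m`, `2m + 2`, `2m + 4` equal; halving the positions
      -- gives a cube.
      apply thueMorse_no_cube m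
      · rw [← thueMorse_two_mul m, ← thueMorse_two_mul (m + 1), mul_add, mul_one, s1, s0]; simp
      · rw [← thueMorse_two_mul (m + 1), ← thueMorse_two_mul (m + 2),
          show 2 * (m + 1) = 2 * m + 2 by ring, show 2 * (m + 2) = 2 * m + 4 by ring, s3, s2]; simp

end ThueMorse

/-! ### Square-freeness and short factors of `vtm` -/

section Vtm

lemma g_isUniform : g.IsUniform 2 := by unfold Morphism.IsUniform; decide

lemma g_zero : g 0 = 0 :: [1] := rfl

lemma sigma_isUniform : sigma.IsUniform 50 := by unfold Morphism.IsUniform; decide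

/-- The letter of `g^ω(0)` that corresponds to two consecutive letters of the Thue–Morse word. -/
def pairLetter : Bool → Bool → Fin 4
  | false, true => 0
  | true, true => 1
  | true, false => 2
  | false, false => 3

/-- The Thue–Morse morphism sends the pair `u v` to `u ū v v̄`, whose first two adjacent pairs are
`u ū` and `ū v`; on coded pairs this is `g`. -/
lemma omega_g_eq (n : ℕ) : g.omega 0 n = pairLetter (thueMorse n) (thueMorse (n + 1)) := by
  refine g_isUniform.omega_eq one_lt_two g_zero
    (y := fun n => pairLetter (thueMorse n) (thueMorse (n + 1))) (by simp [thueMorse, pairLetter])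
    (fun m d hd => ?_) n
  have key : ∀ u v : Bool, pairLetter u (!u) = (g (pairLetter u v)).getD 0 0 ∧
      pairLetter (!u) v = (g (pairLetter u v)).getD 1 0 := by decide
  interval_cases d
  · simpa only [add_zero, thueMorse_two_mul, thueMorse_two_mul_add_one] using (key _ _).1
  · simp only [show 2 * m + 1 + 1 = 2 * (m + 1) by ring, thueMorse_two_mul,
      thueMorse_two_mul_add_one]
    exact (key _ _).2

/-- `vtm` is the word of differences of the Thue–Morse word, shifted by one. -/
lemma vtm_eq (n : ℕ) :
    ((vtm n : ℕ) : ℤ) = (thueMorse (n + 1)).toNat - (thueMorse n).toNat + 1 := by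
  rw [vtm, omega_g_eq]
  generalize thueMorse n = u
  generalize thueMorse (n + 1) = v
  revert u v
  decide

lemma vtm_squareFree {p : ℕ} (hp : 1 ≤ p) (i : ℕ)
    (h : ∀ k < p, vtm (i + k) = vtm (i + k + p)) : False := by
  set T : ℕ → ℤ := fun n => (thueMorse n).toNat with hT
  have hD : ∀ k ≤ p, T (i + k + p) - T (i + k) = T (i + p) - T i := by
    intro k hk
    induction k with
    | zero => simp
    | succ k ih =>
      have e := congrArg (fun a : Fin 3 => ((a : ℕ) : ℤ)) (h k (by omega))
      simp only [vtm_eq] at e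
      have ih := ih (by omega)
      rw [show i + (k + 1) + p = i + k + p + 1 by omega, ← add_assoc]
      simp only [hT] at ih ⊢
      linarith
  have bound : ∀ n, T n = 0 ∨ T n = 1 := by
    intro n; simp only [hT]; cases thueMorse n <;> simp
  have inj : ∀ m n, T m = T n → thueMorse m = thueMorse n := by
    intro m n; simp only [hT]; cases thueMorse m <;> cases thueMorse n <;> simp
  -- If this difference is `c`, then `T (i + 2p) - T i = 2c`, which is at most 1 in absolute value.
  have h0 : T (i + p) - T i = 0 := by
    have := hD p le_rfl
    rcases bound i with h1 | h1 <;> rcases bound (i + p) with h2 | h2 <;>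
      rcases bound (i + p + p) with h3 | h3 <;> omega
  refine thueMorse_overlapFree hp i fun k hk => inj _ _ ?_
  have := hD k hk
  omega

/-- The block of four letters of `g^ω(0)` at position `n`. -/
def window (n : ℕ) : Fin 4 × Fin 4 × Fin 4 × Fin 4 :=
  (g.omega 0 n, g.omega 0 (n + 1), g.omega 0 (n + 2), g.omega 0 (n + 3))

/-- The factors of length four of `g^ω(0)`. -/
def windows : List (Fin 4 × Fin 4 × Fin 4 × Fin 4) :=
  [(0, 1, 2, 0), (0, 1, 2, 3), (0, 2, 0, 1), (0, 2, 3, 0), (1, 2, 0, 2), (1, 2, 3, 0),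
    (2, 0, 1, 2), (2, 0, 2, 3), (2, 3, 0, 1), (2, 3, 0, 2), (3, 0, 1, 2), (3, 0, 2, 0)]

/-- The windows at `2m` and `2m + 1` are determined by the window at `m`, and the list is closed
under both maps. -/
lemma window_mem (n : ℕ) : window n ∈ windows := by
  induction n using Nat.strong_induction_on with
  | _ n ih =>
    rcases Nat.eq_zero_or_pos n with rfl | hn
    · decide
    · obtain ⟨m, hm⟩ : ∃ m, n = 2 * m ∨ n = 2 * m + 1 := ⟨n / 2, by omega⟩
      have hw := ih m (by omega)
      have step : ∀ w ∈ windows,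
          ((g w.1).getD 0 0, (g w.1).getD 1 0, (g w.2.1).getD 0 0, (g w.2.1).getD 1 0) ∈ windows ∧
          ((g w.1).getD 1 0, (g w.2.1).getD 0 0, (g w.2.1).getD 1 0, (g w.2.2.1).getD 0 0)
            ∈ windows := by decide
      have e0 : ∀ m, g.omega 0 (2 * m) = (g (g.omega 0 m)).getD 0 0 := fun m => by
        simpa using g_isUniform.omega_mul_add one_lt_two g_zero m zero_lt_two 0
      have e1 : ∀ m, g.omega 0 (2 * m + 1) = (g (g.omega 0 m)).getD 1 0 := fun m => by
        simpa using g_isUniform.omega_mul_add one_lt_two g_zero m one_lt_two 0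
      obtain ⟨s0, s1⟩ := step _ hw
      simp only [window, ← e0, ← e1, mul_add, mul_one, add_assoc, Nat.reduceAdd] at s0 s1
      rcases hm with rfl | rfl
      · exact s0
      · exact s1

lemma vtm_not_isPlusFree : ¬ IsPlusFree (7 / 4) vtm := by
  intro h
  -- The 15 letters from position 8 have period 8, and 15/8 > 7/4.
  have := h 8 15 8 (by norm_num) (by norm_num) fun t ht => by
    have : ∀ t < 7, vtm (8 + t) = vtm (8 + t + 8) := by
      simp only [vtm, omega_g_eq]
      decide +kernel
    exact this t (by omega)
  norm_num at this

end Vtm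


/-! ### Squares in the image word -/

section Squares

/-- Ochem's word `σ(vtm)`. -/
abbrev ochemWord : ℕ → Fin 2 := sigma.onWord vtm

lemma ochemWord_apply (m : ℕ) {d : ℕ} (hd : d < 50) :
    ochemWord (50 * m + d) = (sigma (vtm m)).getD d 0 :=
  sigma_isUniform.onWord_apply vtm m hd

/-- The natural number whose binary digits, least significant first, are the given word. -/
def bitsToNat : List (Fin 2) → ℕ
  | [] => 0
  | b :: w => b + 2 * bitsToNat w

lemma testBit_bitsToNat (w : List (Fin 2)) (t : ℕ) :
    (bitsToNat w).testBit t = decide (w.getD t 0 = 1) := by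
  induction w generalizing t with
  | nil => simp [bitsToNat]
  | cons b w ih =>
    cases t with
    | zero =>
      simp only [bitsToNat, Nat.testBit_zero, List.getD_cons_zero, Nat.add_mul_mod_self_left]
      revert b; decide
    | succ t =>
      rw [bitsToNat, Nat.testBit_succ, List.getD_cons_succ, ← ih]
      congr 1
      omega

/-- The image under `σ ∘ τ` of a block of four letters, as a natural number. -/
def windowBits (w : Fin 4 × Fin 4 × Fin 4 × Fin 4) : ℕ :=
  bitsToNat (sigma.onList [tau w.1, tau w.2.1, tau w.2.2.1, tau w.2.2.2])

lemma testBit_windowBits (k : ℕ) {t : ℕ} (ht : t < 200) :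
    (windowBits (window k)).testBit t = decide (ochemWord (50 * k + t) = 1) := by
  have hd : t % 50 < 50 := Nat.mod_lt _ (by norm_num)
  have e : 50 * k + t = 50 * (k + t / 50) + t % 50 := by omega
  rw [e, ochemWord_apply _ hd, windowBits, testBit_bitsToNat, List.getD_eq_getElem?_getD,
    List.getD_eq_getElem?_getD]
  conv_lhs => rw [← Nat.div_add_mod t 50, sigma_isUniform.getElem?_onList _ hd]
  have : t / 50 < 4 := by omega
  interval_cases t / 50 <;> rfl

lemma eq_iff_testBit_windowBits (k : ℕ) {s t : ℕ} (hs : s < 200) (ht : t < 200) :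
    ochemWord (50 * k + s) = ochemWord (50 * k + t) ↔
      (windowBits (window k)).testBit s = (windowBits (window k)).testBit t := by
  rw [testBit_windowBits k hs, testBit_windowBits k ht]
  generalize ochemWord (50 * k + s) = a
  generalize ochemWord (50 * k + t) = b
  revert a b
  decide

/-- The number that vanishes if and only if the binary word of `N` has a square of period `p` at
position `r`. -/
def squareDefect (N r p : ℕ) : ℕ := (N >>> r ^^^ N >>> (r + p)) % 2 ^ p

lemma squareDefect_eq_zero {N r p : ℕ} (h : ∀ t < p, N.testBit (r + t) = N.testBit (r + t + p)) :
    squareDefect N r p = 0 := by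
  apply Nat.eq_of_testBit_eq
  intro t
  simp only [squareDefect, Nat.testBit_mod_two_pow, Nat.testBit_xor, Nat.testBit_shiftRight,
    Nat.zero_testBit]
  by_cases ht : t < p
  · rw [h t ht, add_right_comm r p t]; simp
  · simp [ht]

/-- Such a square ends within 49 + 108 < 200 letters, hence inside the window. -/
lemma short_squares : ∀ w ∈ windows, ∀ r < 50, ∀ p < 55, 1 ≤ p →
    squareDefect (windowBits w) r p = 0 →
    p = 1 ∨ p = 2 ∧ (windowBits w).testBit r = false ∧ (windowBits w).testBit (r + 1) = true := by
  decide +kernel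

lemma ochemWord_short_square {i p : ℕ} (hp : 1 ≤ p) (hp' : p < 55)
    (h : ∀ t < p, ochemWord (i + t) = ochemWord (i + t + p)) :
    p = 1 ∨ p = 2 ∧ ochemWord i = 0 ∧ ochemWord (i + 1) = 1 := by
  have hr : i % 50 < 50 := Nat.mod_lt _ (by norm_num)
  have hi : 50 * (i / 50) + i % 50 = i := Nat.div_add_mod i 50
  have key := short_squares _ (window_mem (i / 50)) _ hr p hp' hp
    (squareDefect_eq_zero fun t ht => by
      rw [← eq_iff_testBit_windowBits _ (by omega) (by omega)]
      simpa only [← add_assoc, hi] using h t ht)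
  rw [testBit_windowBits _ (by omega), testBit_windowBits _ (by omega), ← add_assoc, hi] at key
  revert key
  generalize ochemWord i = a
  generalize ochemWord (i + 1) = b
  revert a b
  simp only [decide_eq_false_iff_not, decide_eq_true_eq]
  rcases eq_or_ne p 1 with h1 | h1
  · simp [h1]
  · simp only [h1, false_or]
    rintro a b ⟨h2, ha, hb⟩
    exact ⟨h2, by omega, hb⟩

/-- 24 is `000110` read with the least significant bit first. -/
lemma marker_unique : ∀ w ∈ windows, ∀ r < 50,
    (windowBits w >>> r) % 64 = 24 → r = 0 := by
  decide +kernel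

/-- All images under `σ` begin with `000110`, which occurs at no other positions. -/
lemma marker_position {i : ℕ} (k : ℕ) (h : ∀ t < 6, ochemWord (50 * k + t) = ochemWord (i + t)) :
    i % 50 = 0 := by
  have hr : i % 50 < 50 := Nat.mod_lt _ (by norm_num)
  have hi : 50 * (i / 50) + i % 50 = i := Nat.div_add_mod i 50
  refine marker_unique _ (window_mem (i / 50)) _ hr ?_
  apply Nat.eq_of_testBit_eq
  intro t
  rw [show 64 = 2 ^ 6 by norm_num, Nat.testBit_mod_two_pow, Nat.testBit_shiftRight]
  by_cases ht : t < 6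
  · rw [testBit_windowBits _ (by omega), ← add_assoc, hi, ← h t ht, ochemWord_apply _ (by omega)]
    generalize vtm k = a
    interval_cases t <;> revert a <;> decide
  · simp only [ht, decide_false, Bool.false_and]
    symm
    apply Nat.testBit_lt_two_pow
    calc 24 < 2 ^ 6 := by norm_num
      _ ≤ 2 ^ t := Nat.pow_le_pow_right (by norm_num) (by omega)

lemma sigma_prefix_injective : ∀ a b : Fin 3,
    (∀ t < 30, (sigma a).getD t 0 = (sigma b).getD t 0) → a = b := by
  decide +kernel

lemma sigma_suffix_injective : ∀ a b : Fin 3,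
    (∀ t < 50, 30 ≤ t → (sigma a).getD t 0 = (sigma b).getD t 0) → a = b := by
  decide +kernel

lemma ochemWord_no_long_square {i p : ℕ} (hp : 55 ≤ p)
    (h : ∀ t < p, ochemWord (i + t) = ochemWord (i + t + p)) : False := by
  have h' : ∀ j, i ≤ j → j < i + p → ochemWord j = ochemWord (j + p) := fun j h1 h2 => by
    have := h (j - i) (by omega)
    rwa [show i + (j - i) = j by omega] at this
  obtain ⟨q, rfl⟩ : ∃ q, p = 50 * q := by
    -- The first block boundary at or after `i`. Its six-letter marker ends before `i + 55`, hence
    -- in the first half of the square, and reappears `p` letters later.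
    set k := (i + 49) / 50 with hk
    have : (50 * k + p) % 50 = 0 := marker_position k fun t ht => by
      rw [h' _ (by omega) (by omega), add_right_comm]
    exact ⟨p / 50, by omega⟩
  have block : ∀ m d, d < 50 → i ≤ 50 * m + d → 50 * m + d < i + 50 * q →
      (sigma (vtm m)).getD d 0 = (sigma (vtm (m + q))).getD d 0 := fun m d hd h1 h2 => by
    rw [← ochemWord_apply m hd, ← ochemWord_apply (m + q) hd, h' _ h1 h2]
    congr 1; ring
  -- The blocks cut by the two ends of the first half are covered only in part. Either the first 30
  -- or the last 20 letters of `q` consecutive blocks are covered, and either part determines the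
  -- letter.
  rcases Nat.lt_or_ge 30 (i % 50) with hi | hi
  · refine vtm_squareFree (p := q) (by omega) (i / 50 + 1) fun k hk => ?_
    exact sigma_prefix_injective _ _ fun t ht => block _ t (by omega) (by omega) (by omega)
  · refine vtm_squareFree (p := q) (by omega) (i / 50) fun k hk => ?_
    exact sigma_suffix_injective _ _ fun t ht ht' => block _ t (by omega) (by omega) (by omega)

lemma ochemWord_small {t : ℕ} (ht : t < 50) : ochemWord t = (sigma 2).getD t 0 := by
  simpa [show vtm 0 = 2 from rfl] using ochemWord_apply 0 ht

lemma squaresIn_ochemWord :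
    squaresIn ochemWord = {[0, 0], [1, 1], [0, 1, 0, 1]} := by
  ext w
  simp only [Set.mem_insert_iff, Set.mem_singleton_iff]
  constructor
  · rintro ⟨⟨i, hw⟩, u, hu, rfl⟩
    have hl : 1 ≤ u.length := List.length_pos_iff.2 hu
    have first : ∀ t < u.length, u[t]? = some (ochemWord (i + t)) := fun t ht => by
      have := congrArg (fun l => l[t]?) hw
      simpa [ht, show t < u.length + u.length by omega] using this
    have second : ∀ t < u.length, u[t]? = some (ochemWord (i + t + u.length)) := fun t ht => by
      have := congrArg (fun l => l[u.length + t]?) hw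
      simpa [ht, List.getElem?_append_right, add_assoc, add_comm u.length] using this
    have hsq : ∀ t < u.length, ochemWord (i + t) = ochemWord (i + t + u.length) := fun t ht =>
      Option.some.inj ((first t ht).symm.trans (second t ht))
    rcases Nat.lt_or_ge u.length 55 with h | h
    · rcases ochemWord_short_square hl h hsq with h1 | ⟨h2, ha, hb⟩
      · obtain ⟨b, rfl⟩ := List.length_eq_one_iff.1 h1
        fin_cases b <;> simp
      · obtain ⟨a, b, rfl⟩ := List.length_eq_two.1 h2
        have f0 := first 0 (by simp)
        have f1 := first 1 (by simp)
        simp only [add_zero, ha, hb] at f0 f1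
        simp at f0 f1
        simp [f0, f1]
    · exact (ochemWord_no_long_square h hsq).elim
  · have fact : ∀ u : List (Fin 2), u ≠ [] → ∀ i, i + (u ++ u).length < 50 →
        u ++ u = (List.range (u ++ u).length).map (fun t => (sigma 2).getD (i + t) 0) →
        u ++ u ∈ squaresIn ochemWord := fun u hu i hi h => by
      refine ⟨⟨i, h.trans (List.map_congr_left fun t ht => ?_)⟩, u, hu, rfl⟩
      exact (ochemWord_small (by rw [List.mem_range] at ht; omega)).symm
    -- All three occur in the initial block `σ(2) = 0001100101⋯`.
    rintro (rfl | rfl | rfl)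
    · exact fact [0] (by decide) 0 (by decide) (by decide)
    · exact fact [1] (by decide) 3 (by decide) (by decide)
    · exact fact [0, 1] (by decide) 6 (by decide) (by decide)

lemma ncard_squaresIn_ochemWord : (squaresIn ochemWord).ncard = 3 := by
  rw [squaresIn_ochemWord, Set.ncard_eq_three]
  exact ⟨_, _, _, by decide, by decide, by decide, rfl⟩

end Squares


/-! ### The minimal automaton and the minimal weight -/

section Automaton

/-- The automaton that tracks, for a position `n` of `σ(vtm)`, the letter of `g^ω(0)` at position
`n / 50` and the remainder of `n` modulo `50`. -/
def blockDFAO : DFAO 2 (Fin 4 × Fin 50) (Fin 2) where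
  start := (0, 0)
  step q d := ((g q.1).getD ((2 * q.2 + d) / 50) 0, Fin.ofNat 50 (2 * q.2 + d))
  out q := (sigma (tau q.1)).getD q.2 0

/-- The state of `blockDFAO` that belongs to position `n`. -/
def blockState (n : ℕ) : Fin 4 × Fin 50 := (g.omega 0 (n / 50), Fin.ofNat 50 n)

lemma blockState_two_mul_add (n : ℕ) (d : Fin 2) :
    blockState (2 * n + d) = blockDFAO.step (blockState n) d := by
  have hd := d.2
  simp only [blockState, blockDFAO, Fin.val_ofNat]
  refine Prod.ext ?_ (Fin.ext ?_)
  · have e : (2 * n + d) / 50 = 2 * (n / 50) + (2 * (n % 50) + d) / 50 := by omega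
    simp only
    rw [e, g_isUniform.omega_mul_add one_lt_two g_zero _ (by omega) 0]
  · simp only [Fin.val_ofNat]
    omega

lemma out_blockState (n : ℕ) : blockDFAO.out (blockState n) = ochemWord n := by
  conv_rhs => rw [← Nat.div_add_mod n 50, ochemWord_apply _ (Nat.mod_lt _ (by norm_num))]
  rfl

lemma blockDFAO_run (n : ℕ) : blockDFAO.run (baseRep 2 n) = blockState n := by
  induction n using Nat.strong_induction_on with
  | _ n ih =>
    rcases Nat.eq_zero_or_pos n with rfl | hn
    · rw [baseRep_zero]; rfl
    · obtain ⟨m, d, rfl⟩ : ∃ (m : ℕ) (d : Fin 2), n = 2 * m + d :=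
        ⟨n / 2, ⟨n % 2, by omega⟩, by simp only; omega⟩
      rw [blockDFAO.run_baseRep_mul_add one_lt_two m d hn, ih m (by omega), blockState_two_mul_add]

lemma blockDFAO_generates : blockDFAO.Generates ochemWord := fun n => by
  rw [blockDFAO_run, out_blockState]

lemma blockDFAO_reachable (q : Fin 4 × Fin 50) : ∃ n > 0, blockDFAO.run (baseRep 2 n) = q := by
  obtain ⟨u, r⟩ := q
  obtain ⟨k, hk, rfl⟩ : ∃ k > 0, g.omega 0 k = u := by
    fin_cases u
    -- Position 3 rather than 0, so that `n` is positive even for `r = 0`.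
    · exact ⟨3, by norm_num, rfl⟩
    · exact ⟨1, by norm_num, rfl⟩
    · exact ⟨2, by norm_num, rfl⟩
    · exact ⟨5, by norm_num, rfl⟩
  refine ⟨50 * k + r, by omega, ?_⟩
  rw [blockDFAO_run]
  refine Prod.ext ?_ (Fin.ext ?_)
  · simp only [blockState]
    congr 1
    omega
  · simp only [blockState, Fin.val_ofNat]
    omega

lemma card_behaviour_blockDFAO : (Finset.univ.image (blockDFAO.behaviour 4)).card = 109 := by
  decide +kernel

lemma le_of_mem_automatonSizes {s : ℕ} (hs : s ∈ automatonSizes 2 ochemWord) : 109 ≤ s := by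
  obtain ⟨M, hM⟩ := hs
  rw [← card_behaviour_blockDFAO]
  exact hM.card_behaviour_le one_lt_two blockDFAO_generates blockDFAO_reachable 4

/-- The classes of equivalent states of `blockDFAO`, for the states `(u, r)` in the order of
`50 * u + r`. -/
def classTable : List ℕ :=
  [0, 1, 2, 3, 4, 5, 6, 7, 8, 9, 10, 11, 12, 13, 14, 15, 16, 17, 18, 19, 20, 21, 22, 23, 24,
    25, 26, 27, 28, 29, 30, 31, 32, 33, 34, 35, 36, 37, 38, 39, 40, 41, 42, 43, 44, 45, 46,
    47, 48, 49, 25, 26, 27, 28, 29, 50, 31, 51, 52, 53, 35, 54, 55, 56, 57, 58, 41, 59, 60,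
    61, 62, 63, 64, 65, 66, 0, 1, 67, 3, 4, 5, 6, 68, 69, 70, 10, 71, 12, 13, 72, 73, 16, 17,
    74, 19, 75, 76, 77, 23, 24, 25, 26, 27, 28, 29, 50, 31, 51, 52, 53, 35, 54, 55, 56, 57,
    78, 41, 79, 80, 81, 62, 63, 82, 83, 84, 85, 86, 67, 87, 88, 5, 89, 68, 69, 9, 10, 11, 12,
    90, 72, 91, 92, 93, 94, 95, 96, 97, 98, 99, 100, 0, 1, 2, 3, 4, 5, 6, 7, 8, 9, 10, 11, 12,
    13, 14, 15, 16, 17, 18, 19, 20, 21, 22, 23, 24, 25, 26, 101, 28, 29, 50, 31, 102, 103,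
    104, 35, 105, 55, 56, 106, 78, 41, 59, 80, 61, 107, 108, 82, 65, 66]

/-- The class of a state of `blockDFAO`. -/
def stateClass (q : Fin 4 × Fin 50) : Fin 109 :=
  Fin.ofNat 109 (classTable.getD (50 * q.1 + q.2) 0)

/-- The first state of `blockDFAO` in a given class. -/
def classRep (c : Fin 109) : Fin 4 × Fin 50 :=
  (Fin.ofNat 4 (classTable.findIdx (· == c.val) / 50),
    Fin.ofNat 50 (classTable.findIdx (· == c.val)))

/-- The `2`-uniform morphism on the classes of states of `blockDFAO`. -/
def minimalMorphism : Morphism (Fin 109) (Fin 109) := fun c =>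
  [stateClass (blockDFAO.step (classRep c) 0), stateClass (blockDFAO.step (classRep c) 1)]

/-- The output of a class of states of `blockDFAO`. -/
def minimalCoding (c : Fin 109) : Fin 2 := blockDFAO.out (classRep c)

/-- The partition is a congruence: transitions computed at a representative agree, up to class, with
those at any member. -/
lemma stateClass_step : ∀ (q : Fin 4 × Fin 50) (d : Fin 2),
    stateClass (blockDFAO.step (classRep (stateClass q)) d) = stateClass (blockDFAO.step q d) := by
  decide +kernel

lemma minimalCoding_stateClass : ∀ q, minimalCoding (stateClass q) = blockDFAO.out q := by
  decide +kernel

lemma minimalMorphism_isUniform : minimalMorphism.IsUniform 2 := fun _ => rfl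

lemma minimalMorphism_zero : minimalMorphism 0 = 0 :: [1] := by decide +kernel

lemma minimalMorphism_omega (n : ℕ) : minimalMorphism.omega 0 n = stateClass (blockState n) := by
  refine minimalMorphism_isUniform.omega_eq one_lt_two minimalMorphism_zero
    (y := fun n => stateClass (blockState n)) rfl (fun m d hd => ?_) n
  have := blockState_two_mul_add m ⟨d, hd⟩
  simp only at this
  simp only [this, ← stateClass_step (blockState m)]
  interval_cases d <;> rfl

lemma isDefinedBy_minimalMorphism :
    IsDefinedBy 2 minimalMorphism 0 minimalCoding ochemWord :=
  ⟨minimalMorphism_isUniform, minimalMorphism_isUniform.isProlongable one_lt_two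
    minimalMorphism_zero, fun n => by
      rw [minimalMorphism_omega, minimalCoding_stateClass, out_blockState]⟩

lemma isLeast_automatonSizes : IsLeast (automatonSizes 2 ochemWord) 109 :=
  ⟨⟨_, isDefinedBy_minimalMorphism.generates one_lt_two⟩, fun _ => le_of_mem_automatonSizes⟩

lemma isLeast_definingWeights : IsLeast (definingWeights 2 ochemWord) 218 := by
  refine ⟨⟨109, _, _, _, isDefinedBy_minimalMorphism, minimalMorphism_isUniform.weight_eq⟩, ?_⟩
  rintro w ⟨s, h, a, c, hx, rfl⟩
  have := le_of_mem_automatonSizes ⟨_, hx.generates one_lt_two⟩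
  rw [hx.1.weight_eq]
  omega

end Automaton

end SquareWords

theorem theorem2 :
    SquareWords.sigma.IsUniform 50 ∧
    ¬ SquareWords.IsPlusFree (7 / 4) SquareWords.vtm ∧
    SquareWords.IsAutomatic 2 (SquareWords.sigma.onWord SquareWords.vtm) ∧
    (SquareWords.squaresIn (SquareWords.sigma.onWord SquareWords.vtm)).ncard = 3 ∧
    IsLeast (SquareWords.automatonSizes 2 (SquareWords.sigma.onWord SquareWords.vtm)) 109 ∧
    IsLeast (SquareWords.definingWeights 2 (SquareWords.sigma.onWord SquareWords.vtm)) 218 :=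
  ⟨SquareWords.sigma_isUniform, SquareWords.vtm_not_isPlusFree,
    ⟨109, _, _, _, SquareWords.isDefinedBy_minimalMorphism⟩,
    SquareWords.ncard_squaresIn_ochemWord, SquareWords.isLeast_automatonSizes,
    SquareWords.isLeast_definingWeights⟩
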